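/- Let $\mathbb K\in\{\mathbb R,\mathbb C\}$, let $2\le p<\infty$, and let all spaces be over $\mathbb K$. Let $X$ be a Banach space that is linearly isometric to a subspace of a quotient of $L_p=L_p[0,1]$, i.e. to a subspace of $L_p/N$ with the quotient norm for some closed subspace $N\subseteq L_p$. Suppose that at least one of the following holds. (i) $X$ has a $1$-unconditional finite-dimensional Schauder decomposition: there are finite-dimensional subspaces $X_0,X_1,\dots$ of $X$ such that every $x\in X$ has a unique expansion $x=\sum_{n=0}^\infty x_n$ (norm convergence of the partial sums) with $x_n\in X_n$ for all $n$, and $$\Bigl\|\sum_{n<N}\varepsilon_n x_n\Bigr\|\le\Bigl\|\sum_{n<N}x_n\Bigr\|$$ for all $N\in\mathbb N$, all $x_n\in X_n$ and all signs $\varepsilon_n=\pm1$. (ii) $X$ has the unconditional metric compact approximation property: there is a sequence of compact linear operators $K_n\colon X\to X$ with $K_nx\to x$ for every $x\in X$ and $\|\mathrm{Id}_X-2K_n\|\to1$. Then the space $K(X,\ell_p)$ of compact operators is an $M$-ideal in the space $L(X,\ell_p)$ of bounded linear operators with the operator norm; that is, $K(X,\ell_p)$ is closed in $L(X,\ell_p)$,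 and there is a closed subspace $V$ of $L(X,\ell_p)^*$ such that $$L(X,\ell_p)^*=K(X,\ell_p)^\perp\oplus_1V,$$ where $K(X,\ell_p)^\perp=\{f\in L(X,\ell_p)^*: f|_{K(X,\ell_p)}=0\}$ and $\oplus_1$ means that the sum is direct and $\|f+g\|=\|f\|+\|g\|$ for $f\in K(X,\ell_p)^\perp$, $g\in V$. -/

import Mathlib

open Filter Topology MeasureTheory
open scoped ENNReal

/-- The annihilator `J^⊥ = {f ∈ E* : f|_J = 0}` of a subspace `J` of a normed space `E`, as a
subspace of the topological dual `E*`. -/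
def annihilatorInDual {𝕜 : Type*} [RCLike 𝕜] {E : Type*} [NormedAddCommGroup E] [NormedSpace 𝕜 E]
    (J : Submodule 𝕜 E) : Submodule 𝕜 (StrongDual 𝕜 E) where
  carrier := {f | ∀ x ∈ J, f x = 0}
  add_mem' := by
    intro f g hf hg x hx
    simp [hf x hx, hg x hx]
  zero_mem' := by
    intro x _
    simp
  smul_mem' := by
    intro c f hf x hx
    simp [hf x hx]

/-- A closed subspace `J` of `E` is an M-ideal in `E` if `E* = J^⊥ ⊕₁ V` for some closed
subspace `V` of `E*`. -/
def IsMIdeal {𝕜 : Type*} [RCLike 𝕜] {E : Type*} [NormedAddCommGroup E] [NormedSpace 𝕜 E]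
    (J : Submodule 𝕜 E) : Prop :=
  IsClosed (J : Set E) ∧
    ∃ V : Submodule 𝕜 (StrongDual 𝕜 E),
      IsClosed (V : Set (StrongDual 𝕜 E)) ∧
      IsCompl (annihilatorInDual J) V ∧
      ∀ f ∈ annihilatorInDual J, ∀ g ∈ V, ‖f + g‖ = ‖f‖ + ‖g‖

/-- `X` is (linearly isometric to) a subspace of a quotient of `E`, that is, of the quotient of
`E` by some closed subspace `N`, with the quotient norm. -/
def IsSubspaceOfQuotient (𝕜 : Type*) [RCLike 𝕜] (X : Type*) [NormedAddCommGroup X]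
    [NormedSpace 𝕜 X] (E : Type*) [NormedAddCommGroup E] [NormedSpace 𝕜 E] : Prop :=
  ∃ N : Submodule 𝕜 E, IsClosed (N : Set E) ∧ Nonempty (X →ₗᵢ[𝕜] (E ⧸ N))

/-- The sequence `V` of subspaces is a Schauder decomposition of `X`: every `x` has a unique
expansion `x = ∑ uₙ` with `uₙ ∈ Vₙ`, where the (ordered) series converges in norm. -/
def IsSchauderDecomposition {𝕜 : Type*} [RCLike 𝕜] {X : Type*} [NormedAddCommGroup X]
    [NormedSpace 𝕜 X] (V : ℕ → Submodule 𝕜 X) : Prop :=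
  (∀ n, IsClosed (V n : Set X)) ∧
    ∀ x : X, ∃! u : ℕ → X, (∀ n, u n ∈ V n) ∧
      Tendsto (fun N => ∑ i ∈ Finset.range N, u i) atTop (𝓝 x)

/-- `X` has a 1-unconditional finite-dimensional Schauder decomposition: changing the signs of
the terms of a sum of vectors from the pieces does not increase (hence preserves) the norm. -/
def HasOneUnconditionalFDD (𝕜 : Type*) [RCLike 𝕜] (X : Type*) [NormedAddCommGroup X]
    [NormedSpace 𝕜 X] : Prop :=
  ∃ V : ℕ → Submodule 𝕜 X, IsSchauderDecomposition V ∧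
    (∀ n, FiniteDimensional 𝕜 (V n)) ∧
    ∀ u : ℕ → X, (∀ n, u n ∈ V n) → ∀ (ε : ℕ → ℤˣ) (N : ℕ),
      ‖∑ i ∈ Finset.range N, ε i • u i‖ ≤ ‖∑ i ∈ Finset.range N, u i‖

/-- The unconditional metric compact approximation property: there are compact operators `Kₙ`
on `X` with `Kₙ x → x` for all `x` and `‖Id - 2 Kₙ‖ → 1`. -/
def HasUMCAP (𝕜 : Type*) [RCLike 𝕜] (X : Type*) [NormedAddCommGroup X] [NormedSpace 𝕜 X] : Prop :=
  ∃ K : ℕ → X →L[𝕜] X, (∀ n, IsCompactOperator (K n)) ∧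
    (∀ x, Tendsto (fun n => K n x) atTop (𝓝 x)) ∧
    Tendsto (fun n => ‖ContinuousLinearMap.id 𝕜 X - (2 : 𝕜) • K n‖) atTop (𝓝 1)

/-! Two-point inequalities between `p`-th powers of norms pass from scalars to `L_p` by integration,
to quotients by lifting, and to subspaces by restriction. For scalars the parallelogram law yields
two of them when `p ≥ 2`: Clarkson's inequality and a quadratic smoothness bound. So `X` inherits
both.

Each of (i) and (ii) supplies compact `K n` tending strongly to the identity with `‖Id - 2 K n‖` at
most `1 + ε` eventually. Clarkson's inequality for `x` and `x - 2 K x` gives `‖K x‖ ^ p + ‖x - K x‖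
^ p ≤ ((1 + ε) ‖x‖) ^ p` (`TwoPointBound.norm_rpow_add_norm_rpow_le`). Smoothness gives `f ∘ K n →
f` in norm for every functional `f` (`tendsto_comp_of_smooth`).

Let `P n` be the coordinate truncations of `ℓ_p`. For contractions `T₁`, `T₂` the operator `P n T₁`
is close to `P n T₁ K`, since `P n` has finite rank. For `m ≥ n` the values of `P n T₁ K` and `(Id -
P m) T₂ (Id - K)` have disjoint supports, so their sum has norm at most about `1`. By
`isMIdeal_compactOperator_of_approx` this suffices: the limit of `f (P n T)` along an ultrafilter
defines a projection of the dual with kernel the annihilator, and the estimate makes the splitting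
an `ℓ_1`-sum. -/

/-! ### Scalar power inequalities -/

theorem exists_pow_sub_one_le (n : ℕ) :
    ∃ C : ℝ, 0 ≤ C ∧ ∀ x : ℝ, 1 ≤ x → x ≤ 2 → x ^ n - 1 ≤ C * (x - 1) := by
  induction n with
  | zero => exact ⟨0, le_rfl, fun x _ _ => by simp⟩
  | succ n ih =>
    obtain ⟨C, hC, h⟩ := ih
    refine ⟨2 * C + 1, by positivity, fun x h1 h2 => ?_⟩
    have h3 := h x h1 h2
    have h4 : x * (x ^ n - 1) ≤ 2 * (C * (x - 1)) := by
      have h5 : 0 ≤ x ^ n - 1 := sub_nonneg.2 (one_le_pow₀ h1)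
      nlinarith
    rw [pow_succ]
    linarith

/-- The graph of a convex power lies above its tangents. -/
theorem rpow_tangent_le {α x y : ℝ} (hα : 1 ≤ α) (hx : 0 < x) (hy : 0 ≤ y) :
    x ^ α + α * x ^ (α - 1) * (y - x) ≤ y ^ α := by
  have h := one_add_mul_self_le_rpow_one_add (s := y / x - 1) (by
    have : 0 ≤ y / x := by positivity
    linarith) hα
  have h1 : 1 + (y / x - 1) = y / x := by ring
  rw [h1, Real.div_rpow hy hx.le, le_div_iff₀ (by positivity)] at h
  have h2 : x ^ α = x ^ (α - 1) * x := by
    rw [← Real.rpow_add_one hx.ne']; ring_nf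
  refine le_trans (le_of_eq ?_) h
  rw [h2]
  field_simp

/-- The tangent at `1 + u`, evaluated at `1`, bounds the power by `1 + α u (1 + u) ^ (α - 1)`.
Comparing `(1 + u) ^ (α - 1)` with an integer power shows that it differs from `1` by `O(u)` on the
side that matters. -/
theorem exists_rpow_one_add_le {α : ℝ} (hα : 1 ≤ α) :
    ∃ C : ℝ, 0 ≤ C ∧ ∀ u : ℝ, -1 ≤ u → u ≤ 1 → (1 + u) ^ α ≤ 1 + α * u + C * u ^ 2 := by
  obtain ⟨n, hn⟩ := exists_nat_ge α
  obtain ⟨C, hC, h⟩ := exists_pow_sub_one_le n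
  refine ⟨α * (C + n + 1), by positivity, fun u h1 h2 => ?_⟩
  rcases h1.eq_or_lt with rfl | h1
  · have : (0 : ℝ) ≤ α * (C + n) := by positivity
    norm_num
    rw [Real.zero_rpow (by linarith)]
    nlinarith
  have hx : 0 < 1 + u := by linarith
  have h3 := rpow_tangent_le hα hx zero_le_one
  rw [Real.one_rpow] at h3
  have h4 : ((1 + u) ^ (α - 1) - 1) * u ≤ (C + n + 1) * u ^ 2 := by
    rcases le_total 0 u with hu | hu
    · have h5 : (1 + u) ^ (α - 1) ≤ (1 + u) ^ n := by
        rw [← Real.rpow_natCast]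
        exact Real.rpow_le_rpow_of_exponent_le (by linarith) (by linarith)
      have h6 := h (1 + u) (by linarith) (by linarith)
      have h7 : (1 + u) ^ (α - 1) - 1 ≤ C * u := by linarith
      have h8 := mul_le_mul_of_nonneg_right h7 hu
      have h9 : 0 ≤ ((n : ℝ) + 1) * u ^ 2 := by positivity
      nlinarith
    · have h5 : (1 + u) ^ n ≤ (1 + u) ^ (α - 1) := by
        rw [← Real.rpow_natCast]
        exact Real.rpow_le_rpow_of_exponent_ge hx (by linarith) (by linarith)
      have h6 := one_add_mul_le_pow (a := u) (by linarith) n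
      have h7 : -((1 + u) ^ (α - 1) - 1) ≤ n * (-u) := by linarith
      have h8 := mul_le_mul_of_nonneg_right h7 (neg_nonneg.2 hu)
      have h9 : 0 ≤ (C + 1) * u ^ 2 := by positivity
      nlinarith
  have h5 := mul_le_mul_of_nonneg_left h4 (by linarith : 0 ≤ α)
  nlinarith

theorem Real.add_rpow_le_mul_rpow_add_rpow {a b r : ℝ} (ha : 0 ≤ a) (hb : 0 ≤ b) (hr : 1 ≤ r) :
    (a + b) ^ r ≤ 2 ^ (r - 1) * (a ^ r + b ^ r) := by
  lift a to NNReal using ha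
  lift b to NNReal using hb
  exact_mod_cast NNReal.rpow_add_le_mul_rpow_add_rpow a b hr

/-- Meant for `A = ‖x + t y‖`, `B = ‖x - t y‖`, `a = ‖x‖`, `b = ‖y‖`. Writing `A ^ 2` and `B ^ 2` as
`s (1 ± u)` makes the first-order terms in `u` cancel, so only `O(t ^ 2)` errors remain. -/
theorem exists_rpow_add_rpow_le_smooth {r : ℝ} (hr : 2 ≤ r) :
    ∃ C : ℝ, 0 ≤ C ∧ ∀ A B a b t : ℝ, 0 ≤ A → 0 ≤ B → 0 ≤ a → 0 ≤ b → 0 ≤ t → t ≤ 1 →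
      A ^ 2 + B ^ 2 = 2 * (a ^ 2 + t ^ 2 * b ^ 2) → |A - B| ≤ 2 * t * b →
      A ^ r + B ^ r ≤ (2 + C * t ^ 2) * a ^ r + C * t ^ 2 * b ^ r := by
  have hα : 1 ≤ r / 2 := by linarith
  obtain ⟨C, hC, h⟩ := exists_rpow_one_add_le hα
  refine ⟨(r + 8 * C) * 2 ^ (r / 2 - 1), by positivity,
    fun A B a b t hA hB ha hb ht ht1 hAB hd => ?_⟩
  have hsq : ∀ x : ℝ, 0 ≤ x → (x ^ 2) ^ (r / 2) = x ^ r := fun x hx => by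
    rw [← Real.rpow_natCast, ← Real.rpow_mul hx]
    congr 1
    push_cast
    ring
  set s := a ^ 2 + t ^ 2 * b ^ 2 with hs
  set D := a ^ 2 + b ^ 2 with hD
  have hs0 : 0 ≤ s := by positivity
  have hD0 : 0 ≤ D := by positivity
  have hDr : D ^ (r / 2) ≤ 2 ^ (r / 2 - 1) * (a ^ r + b ^ r) := by
    have := Real.add_rpow_le_mul_rpow_add_rpow (sq_nonneg a) (sq_nonneg b) hα
    rwa [hsq a ha, hsq b hb] at this
  rcases hs0.eq_or_lt with hs0 | hs0
  · have hA0 : A = 0 := by nlinarith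
    have hB0 : B = 0 := by nlinarith
    rw [hA0, hB0, Real.zero_rpow (by linarith), add_zero]
    positivity
  have hsD : s ≤ D := by
    have : t ^ 2 ≤ 1 := pow_le_one₀ ht ht1
    nlinarith [sq_nonneg b]
  set u := (A ^ 2 - B ^ 2) / 2 / s with hu
  have hus : s * u = (A ^ 2 - B ^ 2) / 2 := by rw [hu]; field_simp
  have hA2 : A ^ 2 = s * (1 + u) := by linarith
  have hB2 : B ^ 2 = s * (1 + -u) := by linarith
  have hu1 : -1 ≤ u := by
    by_contra! h1
    nlinarith [sq_nonneg A]
  have hu2 : u ≤ 1 := by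
    by_contra! h1
    nlinarith [sq_nonneg B]
  -- Factor `A ^ 2 - B ^ 2` and use `(A + B) ^ 2 ≤ 2 (A ^ 2 + B ^ 2) = 4 s`.
  have husq : s * u ^ 2 ≤ 4 * t ^ 2 * b ^ 2 := by
    have h1 : (A - B) ^ 2 ≤ (2 * t * b) ^ 2 := sq_le_sq' (abs_le.1 hd).1 (abs_le.1 hd).2
    have h2 : (A + B) ^ 2 ≤ 4 * s := by nlinarith [sq_nonneg (A - B)]
    have h3 : (A - B) ^ 2 * (A + B) ^ 2 ≤ (2 * t * b) ^ 2 * (4 * s) :=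
      mul_le_mul h1 h2 (sq_nonneg _) (sq_nonneg _)
    have h4 : s * (s * u ^ 2) ≤ s * (4 * t ^ 2 * b ^ 2) := by
      have : s * (s * u ^ 2) = (s * u) ^ 2 := by ring
      rw [this, hus]
      exact le_of_eq_of_le (by ring) ((div_le_div_of_nonneg_right h3 zero_le_four).trans_eq
        (by ring : _ = s * (4 * t ^ 2 * b ^ 2)))
    exact le_of_mul_le_mul_left h4 hs0
  have hpow : s ^ (r / 2) = s ^ (r / 2 - 1) * s := by
    rw [← Real.rpow_add_one hs0.ne']; ring_nf
  have hp0 : 0 ≤ s ^ (r / 2 - 1) := by positivity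
  have hsb : s ^ (r / 2 - 1) * b ^ 2 ≤ D ^ (r / 2) := by
    have hD1 : D ^ (r / 2) = D ^ (r / 2 - 1) * D := by
      rw [← Real.rpow_add_one (hs0.trans_le hsD).ne']; ring_nf
    rw [hD1]
    exact mul_le_mul (Real.rpow_le_rpow hs0.le hsD (by linarith))
      (by nlinarith [sq_nonneg a]) (by positivity) (by positivity)
  have h1 : s ^ (r / 2) ≤ a ^ r + r / 2 * t ^ 2 * (s ^ (r / 2 - 1) * b ^ 2) := by
    have := rpow_tangent_le hα hs0 (sq_nonneg a)
    rw [hsq a ha] at this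
    have h2 : a ^ 2 - s = -(t ^ 2 * b ^ 2) := by rw [hs]; ring
    rw [h2] at this
    linarith
  have h2 : A ^ r + B ^ r ≤ s ^ (r / 2) * (2 + 2 * C * u ^ 2) := by
    rw [← hsq A hA, ← hsq B hB, hA2, hB2, Real.mul_rpow hs0.le (by linarith),
      Real.mul_rpow hs0.le (by linarith), ← mul_add]
    have h3 := h u hu1 hu2
    have h4 := h (-u) (by linarith) (by linarith)
    rw [neg_sq] at h4
    exact mul_le_mul_of_nonneg_left (by linarith) (by positivity)
  have h3 : s ^ (r / 2) * u ^ 2 ≤ 4 * t ^ 2 * (s ^ (r / 2 - 1) * b ^ 2) := by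
    rw [hpow, mul_assoc]
    exact (mul_le_mul_of_nonneg_left husq hp0).trans_eq (by ring)
  have h5 : s ^ (r / 2 - 1) * b ^ 2 ≤ 2 ^ (r / 2 - 1) * (a ^ r + b ^ r) := hsb.trans hDr
  calc A ^ r + B ^ r ≤ 2 * s ^ (r / 2) + 2 * C * (s ^ (r / 2) * u ^ 2) := by linarith
    _ ≤ 2 * (a ^ r + r / 2 * t ^ 2 * (s ^ (r / 2 - 1) * b ^ 2)) +
        2 * C * (4 * t ^ 2 * (s ^ (r / 2 - 1) * b ^ 2)) := by gcongr
    _ = 2 * a ^ r + (r + 8 * C) * t ^ 2 * (s ^ (r / 2 - 1) * b ^ 2) := by ring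
    _ ≤ 2 * a ^ r + (r + 8 * C) * t ^ 2 * (2 ^ (r / 2 - 1) * (a ^ r + b ^ r)) := by gcongr
    _ = _ := by ring

/-- With exponent `r / 2 ≥ 1` applied to the squares, superadditivity of the power bounds the left
side and convexity bounds the resulting power of `a ^ 2 + b ^ 2`. -/
theorem rpow_add_rpow_le_clarkson {r A B a b : ℝ} (hr : 2 ≤ r) (hA : 0 ≤ A) (hB : 0 ≤ B)
    (ha : 0 ≤ a) (hb : 0 ≤ b) (h : A ^ 2 + B ^ 2 = 2 * (a ^ 2 + b ^ 2)) :
    A ^ r + B ^ r ≤ 2 ^ (r - 1) * (a ^ r + b ^ r) := by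
  have hα : 1 ≤ r / 2 := by linarith
  have hsq : ∀ x : ℝ, 0 ≤ x → (x ^ 2) ^ (r / 2) = x ^ r := fun x hx => by
    rw [← Real.rpow_natCast, ← Real.rpow_mul hx]
    congr 1
    push_cast
    ring
  have h1 := Real.add_rpow_le_rpow_add (sq_nonneg A) (sq_nonneg B) hα
  have h2 := Real.add_rpow_le_mul_rpow_add_rpow (sq_nonneg a) (sq_nonneg b) hα
  rw [hsq A hA, hsq B hB, h, Real.mul_rpow (by norm_num) (by positivity)] at h1
  rw [hsq a ha, hsq b hb] at h2
  calc A ^ r + B ^ r ≤ 2 ^ (r / 2) * (a ^ 2 + b ^ 2) ^ (r / 2) := h1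
    _ ≤ 2 ^ (r / 2) * (2 ^ (r / 2 - 1) * (a ^ r + b ^ r)) := by gcongr
    _ = 2 ^ (r - 1) * (a ^ r + b ^ r) := by
      rw [← mul_assoc, ← Real.rpow_add (by norm_num)]
      ring_nf

/-! ### Two-point inequalities and their inheritance -/

/-- The operator `(x, y) ↦ (x + c y, x - c y)` is bounded on `E × E` for (weighted) `r`-norms. -/
def TwoPointBound (𝕜 : Type*) [RCLike 𝕜] (E : Type*) [SeminormedAddCommGroup E] [NormedSpace 𝕜 E]
    (r c A B : ℝ) : Prop :=
  ∀ x y : E, ‖x + (c : 𝕜) • y‖ ^ r + ‖x - (c : 𝕜) • y‖ ^ r ≤ A * ‖x‖ ^ r + B * ‖y‖ ^ r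

namespace TwoPointBound

variable {𝕜 : Type*} [RCLike 𝕜]

theorem of_linearIsometry {E F : Type*} [SeminormedAddCommGroup E] [NormedSpace 𝕜 E]
    [SeminormedAddCommGroup F] [NormedSpace 𝕜 F] {r c A B : ℝ} (h : TwoPointBound 𝕜 F r c A B)
    (i : E →ₗᵢ[𝕜] F) : TwoPointBound 𝕜 E r c A B := fun x y => by
  simpa only [← map_smul, ← map_add, ← map_sub, i.norm_map] using h (i x) (i y)

/-- Lift both classes with norm loss `ε`, use that the quotient map is a contraction, and let `ε →
0`. -/
theorem quotient {E : Type*} [NormedAddCommGroup E] [NormedSpace 𝕜 E] {r c A B : ℝ}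
    (h : TwoPointBound 𝕜 E r c A B) (hr : 0 < r) (hA : 0 ≤ A) (hB : 0 ≤ B) (N : Submodule 𝕜 E) :
    TwoPointBound 𝕜 (E ⧸ N) r c A B := fun x y => by
  have key : ∀ ε : ℝ, 0 < ε → ‖x + (c : 𝕜) • y‖ ^ r + ‖x - (c : 𝕜) • y‖ ^ r ≤
      A * (‖x‖ + ε) ^ r + B * (‖y‖ + ε) ^ r := fun ε hε => by
    obtain ⟨a, rfl, ha⟩ := Submodule.Quotient.norm_mk_lt x hε
    obtain ⟨b, rfl, hb⟩ := Submodule.Quotient.norm_mk_lt y hε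
    calc _ ≤ ‖a + (c : 𝕜) • b‖ ^ r + ‖a - (c : 𝕜) • b‖ ^ r := by
          rw [← Submodule.Quotient.mk_smul, ← Submodule.Quotient.mk_add,
            ← Submodule.Quotient.mk_sub]
          gcongr <;> exact Submodule.Quotient.norm_mk_le _ _
      _ ≤ A * ‖a‖ ^ r + B * ‖b‖ ^ r := h a b
      _ ≤ _ := by gcongr
  have hlim : ∀ z : ℝ, Tendsto (fun ε : ℝ => (z + ε) ^ r) (𝓝[>] 0) (𝓝 (z ^ r)) := fun z => by
    have : ContinuousAt (fun ε : ℝ => (z + ε) ^ r) 0 :=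
      ContinuousAt.rpow_const (by fun_prop) (Or.inr hr.le)
    have h2 := this.tendsto.mono_left (nhdsWithin_le_nhds (s := Set.Ioi 0))
    simpa using h2
  exact ge_of_tendsto (((hlim _).const_mul A).add ((hlim _).const_mul B))
    (eventually_nhdsWithin_of_forall fun ε hε => key ε hε)

theorem lp_norm_rpow {Ω : Type*} [MeasurableSpace Ω] {μ : Measure Ω} {p : ℝ≥0∞} [Fact (1 ≤ p)]
    (hp : p ≠ ⊤) (f : Lp 𝕜 p μ) : ‖f‖ ^ p.toReal = ∫ ω, ‖f ω‖ ^ p.toReal ∂μ := by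
  have hp0 : p ≠ 0 := (zero_lt_one.trans_le Fact.out).ne'
  have hpr : 0 < p.toReal := ENNReal.toReal_pos hp0 hp
  have hnn : 0 ≤ ∫ ω, ‖f ω‖ ^ p.toReal ∂μ := integral_nonneg fun _ => by positivity
  rw [Lp.norm_def, (Lp.memLp f).eLpNorm_eq_integral_rpow_norm hp0 hp,
    ENNReal.toReal_ofReal (by positivity), ← Real.rpow_mul hnn, inv_mul_cancel₀ hpr.ne',
    Real.rpow_one]

theorem lp {Ω : Type*} [MeasurableSpace Ω] (μ : Measure Ω) {p : ℝ≥0∞} [Fact (1 ≤ p)]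
    (hp : p ≠ ⊤) {c A B : ℝ} (h : TwoPointBound 𝕜 𝕜 p.toReal c A B) :
    TwoPointBound 𝕜 (Lp 𝕜 p μ) p.toReal c A B := fun x y => by
  have hp0 : p ≠ 0 := (zero_lt_one.trans_le Fact.out).ne'
  have hint : ∀ f : Lp 𝕜 p μ, Integrable (fun ω => ‖f ω‖ ^ p.toReal) μ := fun f =>
    (Lp.memLp f).integrable_norm_rpow hp0 hp
  simp only [lp_norm_rpow hp]
  rw [← integral_add (hint _) (hint _), ← integral_const_mul, ← integral_const_mul,
    ← integral_add ((hint x).const_mul A) ((hint y).const_mul B)]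
  refine integral_mono_ae ((hint _).add (hint _))
    (((hint x).const_mul A).add ((hint y).const_mul B)) ?_
  filter_upwards [Lp.coeFn_add x ((c : 𝕜) • y), Lp.coeFn_sub x ((c : 𝕜) • y),
    Lp.coeFn_smul (c : 𝕜) y] with ω h1 h2 h3
  simpa only [h1, h2, h3, Pi.add_apply, Pi.sub_apply, Pi.smul_apply] using h (x ω) (y ω)

theorem clarkson_scalar {r : ℝ} (hr : 2 ≤ r) :
    TwoPointBound 𝕜 𝕜 r 1 (2 ^ (r - 1)) (2 ^ (r - 1)) := fun x y => by
  have h := parallelogram_law_with_norm 𝕜 x y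
  rw [RCLike.ofReal_one, one_smul, ← mul_add]
  exact rpow_add_rpow_le_clarkson hr (norm_nonneg _) (norm_nonneg _) (norm_nonneg _)
    (norm_nonneg _) (by linarith)

theorem exists_smooth_scalar {r : ℝ} (hr : 2 ≤ r) : ∃ C : ℝ, 0 ≤ C ∧ ∀ t : ℝ, 0 ≤ t → t ≤ 1 →
    TwoPointBound 𝕜 𝕜 r t (2 + C * t ^ 2) (C * t ^ 2) := by
  obtain ⟨C, hC, h⟩ := exists_rpow_add_rpow_le_smooth hr
  refine ⟨C, hC, fun t ht ht1 x y => ?_⟩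
  have hn : ‖(t : 𝕜) • y‖ = t * ‖y‖ := by
    rw [norm_smul, RCLike.norm_ofReal, abs_of_nonneg ht]
  have h1 := parallelogram_law_with_norm 𝕜 x ((t : 𝕜) • y)
  rw [hn] at h1
  refine h _ _ _ _ t (norm_nonneg _) (norm_nonneg _) (norm_nonneg _) (norm_nonneg _) ht ht1
    (by linarith) ?_
  calc _ ≤ ‖(x + (t : 𝕜) • y) - (x - (t : 𝕜) • y)‖ := abs_norm_sub_norm_le _ _
    _ = ‖(t : 𝕜) • y + (t : 𝕜) • y‖ := by congr 1; ring
    _ ≤ ‖(t : 𝕜) • y‖ + ‖(t : 𝕜) • y‖ := norm_add_le _ _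
    _ = 2 * t * ‖y‖ := by rw [hn]; ring

end TwoPointBound

/-- Clarkson's inequality in subspaces of quotients of `L_p`, `2 ≤ p < ∞`. -/
theorem IsSubspaceOfQuotient.clarkson {𝕜 : Type*} [RCLike 𝕜] {X : Type*} [NormedAddCommGroup X]
    [NormedSpace 𝕜 X] {Ω : Type*} [MeasurableSpace Ω] {μ : Measure Ω} {p : ℝ≥0∞} [Fact (1 ≤ p)]
    (hp2 : 2 ≤ p) (hp : p ≠ ⊤) (hX : IsSubspaceOfQuotient 𝕜 X (Lp 𝕜 p μ)) :
    TwoPointBound 𝕜 X p.toReal 1 (2 ^ (p.toReal - 1)) (2 ^ (p.toReal - 1)) := by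
  obtain ⟨N, -, ⟨i⟩⟩ := hX
  have hr : 2 ≤ p.toReal := by simpa using ENNReal.toReal_mono hp hp2
  exact (((TwoPointBound.clarkson_scalar hr).lp μ hp).quotient (by linarith) (by positivity)
    (by positivity) N).of_linearIsometry i

/-- Uniform smoothness of subspaces of quotients of `L_p`, `2 ≤ p < ∞`. -/
theorem IsSubspaceOfQuotient.exists_smooth {𝕜 : Type*} [RCLike 𝕜] {X : Type*}
    [NormedAddCommGroup X] [NormedSpace 𝕜 X] {Ω : Type*} [MeasurableSpace Ω] {μ : Measure Ω}
    {p : ℝ≥0∞} [Fact (1 ≤ p)] (hp2 : 2 ≤ p) (hp : p ≠ ⊤)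
    (hX : IsSubspaceOfQuotient 𝕜 X (Lp 𝕜 p μ)) : ∃ C : ℝ, 0 ≤ C ∧ ∀ t : ℝ, 0 ≤ t → t ≤ 1 →
      TwoPointBound 𝕜 X p.toReal t (2 + C * t ^ 2) (C * t ^ 2) := by
  obtain ⟨N, -, ⟨i⟩⟩ := hX
  have hr : 2 ≤ p.toReal := by simpa using ENNReal.toReal_mono hp hp2
  obtain ⟨C, hC, h⟩ := TwoPointBound.exists_smooth_scalar (𝕜 := 𝕜) hr
  exact ⟨C, hC, fun t ht ht1 => (((h t ht ht1).lp μ hp).quotient (by linarith) (by positivity)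
    (by positivity) N).of_linearIsometry i⟩

/-! ### Compact approximations from a decomposition -/

/-- A finite-dimensional decomposition which is `1`-unconditional yields compact operators `Kₙ`
with `Kₙ x → x` and `‖Id - 2 Kₙ‖ ≤ 1`, namely the partial sum projections. -/
theorem HasOneUnconditionalFDD.exists_compact_approx {𝕜 : Type*} [RCLike 𝕜] {X : Type*}
    [NormedAddCommGroup X] [NormedSpace 𝕜 X] (h : HasOneUnconditionalFDD 𝕜 X) :
    ∃ K : ℕ → X →L[𝕜] X, (∀ n, IsCompactOperator (K n)) ∧
      (∀ x, Tendsto (fun n => K n x) atTop (𝓝 x)) ∧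
      ∀ n, ‖ContinuousLinearMap.id 𝕜 X - (2 : 𝕜) • K n‖ ≤ 1 := by
  obtain ⟨V, ⟨-, hV⟩, hfd, hunc⟩ := h
  choose u hu huniq using hV
  have hmem : ∀ x n, u x n ∈ V n := fun x => (hu x).1
  have hlim : ∀ x, Tendsto (fun N => ∑ i ∈ Finset.range N, u x i) atTop (𝓝 x) :=
    fun x => (hu x).2
  have hadd : ∀ x y, u (x + y) = u x + u y := fun x y =>
    (huniq (x + y) _ ⟨fun n => (V n).add_mem (hmem x n) (hmem y n), by
      simpa only [Pi.add_apply, Finset.sum_add_distrib] using (hlim x).add (hlim y)⟩).symm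
  have hsmul : ∀ (c : 𝕜) x, u (c • x) = c • u x := fun c x =>
    (huniq (c • x) _ ⟨fun n => (V n).smul_mem c (hmem x n), by
      simpa only [Pi.smul_apply, Finset.smul_sum] using (hlim x).const_smul c⟩).symm
  let L : ℕ → X →ₗ[𝕜] X := fun N =>
    { toFun := fun x => ∑ i ∈ Finset.range N, u x i
      map_add' := fun x y => by simp only [hadd, Pi.add_apply, Finset.sum_add_distrib]
      map_smul' := fun c x => by
        simp only [hsmul, Pi.smul_apply, Finset.smul_sum, RingHom.id_apply] }
  have hsign : ∀ N x, ‖x - (2 : 𝕜) • L N x‖ ≤ ‖x‖ := fun N x => by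
    refine le_of_tendsto_of_tendsto (((hlim x).sub_const _).norm) (hlim x).norm ?_
    filter_upwards [eventually_ge_atTop N] with M hM
    -- Flipping the signs of the first `N` terms turns the `M`-th partial sum of `x` into that sum
    -- minus `2 L N x`; then `M → ∞`.
    have h1 := hunc (u x) (hmem x) (fun i => if i < N then -1 else 1) M
    refine le_trans (le_of_eq ?_) h1
    congr 1
    change _ - (2 : 𝕜) • (∑ i ∈ Finset.range N, u x i) = _
    rw [← Finset.sum_range_add_sum_Ico _ hM, ← Finset.sum_range_add_sum_Ico _ hM]
    have e1 : ∑ i ∈ Finset.range N, (if i < N then (-1 : ℤˣ) else 1) • u x i =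
        -∑ i ∈ Finset.range N, u x i := by
      rw [← Finset.sum_neg_distrib]
      refine Finset.sum_congr rfl fun i hi => ?_
      rw [if_pos (Finset.mem_range.1 hi)]
      simp [Units.smul_def]
    have e2 : ∑ i ∈ Finset.Ico N M, (if i < N then (-1 : ℤˣ) else 1) • u x i =
        ∑ i ∈ Finset.Ico N M, u x i := by
      refine Finset.sum_congr rfl fun i hi => ?_
      rw [if_neg (not_lt.2 (Finset.mem_Ico.1 hi).1), one_smul]
    rw [e1, e2, two_smul]
    abel
  have hbound : ∀ N x, ‖L N x‖ ≤ 1 * ‖x‖ := fun N x => by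
    have h1 : (2 : 𝕜) • L N x = x - (x - (2 : 𝕜) • L N x) := by abel
    have h2 : ‖(2 : 𝕜) • L N x‖ ≤ ‖x‖ + ‖x‖ := by
      rw [h1]
      exact (norm_sub_le _ _).trans (add_le_add_right (hsign N x) _)
    rw [norm_smul, RCLike.norm_ofNat] at h2
    linarith
  refine ⟨fun N => (L N).mkContinuous 1 (hbound N), fun N => ?_, hlim, fun N =>
    ContinuousLinearMap.opNorm_le_bound _ zero_le_one fun x => by simpa using hsign N x⟩
  let W : Submodule 𝕜 X := (Finset.range N).sup V
  have hW : FiniteDimensional 𝕜 W := Submodule.finiteDimensional_finset_sup _ _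
  have hLW : ∀ x, (L N).mkContinuous 1 (hbound N) x ∈ W := fun x =>
    W.sum_mem fun i hi => (Finset.le_sup (f := V) hi) (hmem x i)
  have : ProperSpace W := FiniteDimensional.proper 𝕜 W
  have h1 : IsCompactOperator (((L N).mkContinuous 1 (hbound N)).codRestrict W hLW) :=
    isCompactOperator_of_locallyCompactSpace_dom _
  exact h1.clm_comp W.subtypeL

/-! ### Unconditional approximations under smoothness and Clarkson's inequality -/

theorem RCLike.exists_norm_one_mul_eq {𝕜 : Type*} [RCLike 𝕜] (z : 𝕜) :
    ∃ c : 𝕜, ‖c‖ = 1 ∧ c * z = (‖z‖ : 𝕜) := by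
  obtain ⟨c, hc, h⟩ := RCLike.exists_norm_eq_mul_self z
  exact ⟨c, hc, h.symm⟩

section

variable {𝕜 : Type*} [RCLike 𝕜] {X : Type*} [NormedAddCommGroup X] [NormedSpace 𝕜 X]

theorem norm_apply_le_of_norm_id_sub_two_smul_le {K : X →L[𝕜] X} {ε : ℝ}
    (h : ‖ContinuousLinearMap.id 𝕜 X - (2 : 𝕜) • K‖ ≤ 1 + ε) (x : X) :
    ‖K x‖ ≤ (1 + ε / 2) * ‖x‖ := by
  have h0 : ‖x - (2 : 𝕜) • K x‖ ≤ (1 + ε) * ‖x‖ := by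
    simpa using ContinuousLinearMap.le_of_opNorm_le _ h x
  have h1 : (2 : 𝕜) • K x = x - (x - (2 : 𝕜) • K x) := by abel
  have h2 : ‖(2 : 𝕜) • K x‖ ≤ ‖x‖ + (1 + ε) * ‖x‖ := by
    rw [h1]
    exact (norm_sub_le _ _).trans (add_le_add_right h0 _)
  rw [norm_smul, RCLike.norm_ofNat] at h2
  linarith

/-- The tangent to the `r`-th power at `1` converts the bound on powers into one on the norms
themselves. -/
theorem TwoPointBound.norm_add_norm_sub_le {r t C : ℝ} (hr : 1 ≤ r) (hC : 0 ≤ C)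
    (h : TwoPointBound 𝕜 X r t (2 + C * t ^ 2) (C * t ^ 2)) {x y : X} (hx : ‖x‖ ≤ 1)
    (hy : ‖y‖ ≤ 1) : ‖x + (t : 𝕜) • y‖ + ‖x - (t : 𝕜) • y‖ ≤ 2 + 2 * C * t ^ 2 := by
  have h1 := h x y
  have hx1 : ‖x‖ ^ r ≤ 1 := Real.rpow_le_one (norm_nonneg _) hx (by linarith)
  have hy1 : ‖y‖ ^ r ≤ 1 := Real.rpow_le_one (norm_nonneg _) hy (by linarith)
  have h2 := rpow_tangent_le hr zero_lt_one (norm_nonneg (x + (t : 𝕜) • y))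
  have h3 := rpow_tangent_le hr zero_lt_one (norm_nonneg (x - (t : 𝕜) • y))
  rw [Real.one_rpow, Real.one_rpow] at h2 h3
  have hCt : 0 ≤ C * t ^ 2 := by positivity
  have h4 := mul_le_mul_of_nonneg_left hx1 (by linarith : 0 ≤ 2 + C * t ^ 2)
  have h5 := mul_le_mul_of_nonneg_left hy1 hCt
  have h6 : r * (‖x + (t : 𝕜) • y‖ + ‖x - (t : 𝕜) • y‖ - 2) ≤ 2 * C * t ^ 2 := by linarith
  by_contra! h7
  nlinarith

/-- In a uniformly smooth space, the adjoints of an unconditional approximating sequence converge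
pointwise in norm. -/
theorem tendsto_comp_of_smooth {r C : ℝ} (hr : 1 ≤ r) (hC : 0 ≤ C)
    (hX : ∀ t : ℝ, 0 ≤ t → t ≤ 1 → TwoPointBound 𝕜 X r t (2 + C * t ^ 2) (C * t ^ 2))
    {K : ℕ → X →L[𝕜] X} (hK : ∀ x, Tendsto (fun n => K n x) atTop (𝓝 x))
    (hK1 : ∀ ε > 0, ∀ᶠ n in atTop, ‖ContinuousLinearMap.id 𝕜 X - (2 : 𝕜) • K n‖ ≤ 1 + ε)
    (f : StrongDual 𝕜 X) : Tendsto (fun n => f ∘L K n) atTop (𝓝 f) := by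
  suffices H : ∀ g : StrongDual 𝕜 X, ‖g‖ = 1 → Tendsto (fun n => g ∘L K n) atTop (𝓝 g) by
    rcases eq_or_ne f 0 with rfl | hf
    · simp
    have hf' : (‖f‖ : 𝕜) ≠ 0 := by simpa using hf
    have h1 := (H ((‖f‖ : 𝕜)⁻¹ • f) (norm_smul_inv_norm hf)).const_smul (‖f‖ : 𝕜)
    simpa [ContinuousLinearMap.smul_comp, smul_smul, hf'] using h1
  intro f hf
  rw [Metric.tendsto_atTop']
  suffices H : ∀ δ > 0, ∀ᶠ n in atTop, ‖f ∘L K n - f‖ ≤ δ by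
    intro δ hδ
    obtain ⟨N, hN⟩ := eventually_atTop.1 (H (δ / 2) (by positivity))
    exact ⟨N, fun n hn => by
      rw [dist_eq_norm]
      exact (hN n hn.le).trans_lt (by linarith)⟩
  intro δ hδ
  -- The errors below are all `O(t ^ 2)`: `2 C t ^ 2` from smoothness, the rest from the excess norm
  -- of `K n`, from `x` only almost norming `f`, and from `K n x - x`. They bound `t ‖f y - f (K n
  -- y)‖`, so dividing by `t` leaves `O(t)`.
  obtain ⟨t, ht0, ht1, htδ⟩ : ∃ t : ℝ, 0 < t ∧ t ≤ 1 ∧ (2 * C + 5) * t ≤ δ := by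
    refine ⟨min 1 (δ / (2 * C + 5)), by positivity, min_le_left _ _, ?_⟩
    rw [mul_comm, ← le_div_iff₀ (by positivity)]
    exact min_le_right _ _
  have ht2 : 0 < t ^ 2 := by positivity
  obtain ⟨x, hx1, hfx⟩ : ∃ x : X, ‖x‖ ≤ 1 ∧ 1 - t ^ 2 < RCLike.re (f x) := by
    obtain ⟨x, hx1, hx2⟩ := f.exists_lt_apply_of_lt_opNorm (r := 1 - t ^ 2) (by linarith)
    obtain ⟨c, hc, hcx⟩ := RCLike.exists_norm_one_mul_eq (f x)
    refine ⟨c • x, by rw [norm_smul, hc, one_mul]; exact hx1.le, ?_⟩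
    rwa [map_smul, smul_eq_mul, hcx, RCLike.ofReal_re]
  filter_upwards [hK1 (t ^ 2) ht2, (hK x).eventually (Metric.ball_mem_nhds x ht2)] with n hn1 hn2
  rw [dist_eq_norm] at hn2
  have hmain : ∀ y : X, ‖y‖ ≤ 1 → ‖(f ∘L K n - f) y‖ ≤ δ := by
    intro y hy
    obtain ⟨c, hc, hcy⟩ := RCLike.exists_norm_one_mul_eq (f y - f (K n y))
    have hcy1 : ‖c • y‖ ≤ 1 := by rwa [norm_smul, hc, one_mul]
    have hsum := (hX t ht0.le ht1).norm_add_norm_sub_le hr hC hx1 hcy1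
    -- Testing `f` on one perturbation and `f ∘ K n` on the opposite one isolates the difference `f
    -- - f ∘ K n` at `y`, while smoothness keeps the sum close to `2`.
    have hval : f (x + (t : 𝕜) • c • y) + f (K n (x - (t : 𝕜) • c • y)) =
        f x + f x + f (K n x - x) + ((t * ‖f y - f (K n y)‖ : ℝ) : 𝕜) := by
      rw [RCLike.ofReal_mul, ← hcy]
      simp only [map_add, map_sub, map_smul, smul_eq_mul]
      ring
    have hre := congrArg RCLike.re hval
    rw [AddMonoidHom.map_add, AddMonoidHom.map_add, AddMonoidHom.map_add,
      AddMonoidHom.map_add, RCLike.ofReal_re] at hre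
    have hop : ∀ z, ‖f z‖ ≤ ‖z‖ := fun z => by simpa [hf] using f.le_opNorm z
    have h1 : RCLike.re (f (x + (t : 𝕜) • c • y)) ≤ ‖x + (t : 𝕜) • c • y‖ :=
      (RCLike.re_le_norm _).trans (hop _)
    have h2 : RCLike.re (f (K n (x - (t : 𝕜) • c • y))) ≤
        (1 + t ^ 2 / 2) * ‖x - (t : 𝕜) • c • y‖ :=
      ((RCLike.re_le_norm _).trans (hop _)).trans
        (norm_apply_le_of_norm_id_sub_two_smul_le hn1 _)
    have h3 : -t ^ 2 ≤ RCLike.re (f (K n x - x)) := by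
      have := (abs_le.1 ((RCLike.abs_re_le_norm (f (K n x - x))).trans (hop _))).1
      linarith
    have h4 : ‖x - (t : 𝕜) • c • y‖ ≤ 2 := by
      refine (norm_sub_le _ _).trans ?_
      rw [norm_smul, RCLike.norm_ofReal, abs_of_pos ht0]
      nlinarith [norm_nonneg (c • y)]
    have h5 : t ^ 2 / 2 * ‖x - (t : 𝕜) • c • y‖ ≤ t ^ 2 / 2 * 2 :=
      mul_le_mul_of_nonneg_left h4 (by positivity)
    have h6 : t * ‖f y - f (K n y)‖ ≤ t * ((2 * C + 5) * t) := by nlinarith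
    have h7 := le_of_mul_le_mul_left h6 ht0
    rw [sub_apply, ContinuousLinearMap.comp_apply, norm_sub_rev]
    exact h7.trans htδ
  exact ContinuousLinearMap.opNorm_le_of_unit_norm hδ.le fun y hy => hmain y hy.le

/-- The sum and difference of `x` and `x - 2 K x` are `2 (x - K x)` and `2 K x`, and both vectors
have norm at most `(1 + ε) ‖x‖`. -/
theorem TwoPointBound.norm_rpow_add_norm_rpow_le {r ε : ℝ} (hr : 0 ≤ r)
    (h : TwoPointBound 𝕜 X r 1 (2 ^ (r - 1)) (2 ^ (r - 1))) (hε : 0 ≤ ε) {K : X →L[𝕜] X}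
    (hK : ‖ContinuousLinearMap.id 𝕜 X - (2 : 𝕜) • K‖ ≤ 1 + ε) (x : X) :
    ‖K x‖ ^ r + ‖x - K x‖ ^ r ≤ ((1 + ε) * ‖x‖) ^ r := by
  have h0 : ‖x - (2 : 𝕜) • K x‖ ≤ (1 + ε) * ‖x‖ := by
    simpa using ContinuousLinearMap.le_of_opNorm_le _ hK x
  have h1 := h x (-(x - (2 : 𝕜) • K x))
  have e1 : x + ((1 : ℝ) : 𝕜) • -(x - (2 : 𝕜) • K x) = (2 : 𝕜) • K x := by
    rw [RCLike.ofReal_one, one_smul]; abel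
  have e2 : x - ((1 : ℝ) : 𝕜) • -(x - (2 : 𝕜) • K x) = (2 : 𝕜) • (x - K x) := by
    rw [RCLike.ofReal_one, one_smul, smul_sub, two_smul 𝕜 x]; abel
  rw [e1, e2, norm_smul, norm_smul, RCLike.norm_ofNat, Real.mul_rpow zero_le_two (norm_nonneg _),
    Real.mul_rpow zero_le_two (norm_nonneg _), norm_neg] at h1
  have h2 : ‖x‖ ^ r ≤ ((1 + ε) * ‖x‖) ^ r :=
    Real.rpow_le_rpow (norm_nonneg _) (by nlinarith [norm_nonneg x]) hr
  have h3 : ‖x - (2 : 𝕜) • K x‖ ^ r ≤ ((1 + ε) * ‖x‖) ^ r :=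
    Real.rpow_le_rpow (norm_nonneg _) h0 hr
  have h4 : (2 : ℝ) ^ r = 2 ^ (r - 1) * 2 := by
    rw [← Real.rpow_add_one two_ne_zero]; ring_nf
  rw [h4] at h1
  have h5 : (0 : ℝ) < 2 ^ (r - 1) := by positivity
  refine le_of_mul_le_mul_left ?_ (by positivity : (0 : ℝ) < 2 ^ (r - 1) * 2)
  nlinarith

end

/-! ### A criterion for compact operators to be an M-ideal -/

section

variable {𝕜 : Type*} [RCLike 𝕜] {X Y : Type*} [NormedAddCommGroup X] [NormedSpace 𝕜 X]
  [NormedAddCommGroup Y] [NormedSpace 𝕜 Y]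

theorem ContinuousLinearMap.norm_comp_le_of_norm_le_one {P : Y →L[𝕜] Y} (hP : ‖P‖ ≤ 1)
    (T : X →L[𝕜] Y) : ‖P ∘L T‖ ≤ ‖T‖ :=
  (P.opNorm_comp_le T).trans (mul_le_of_le_one_left (norm_nonneg _) hP)

/-- Strong convergence of contractions is uniform on totally bounded sets, here on the image of the
unit ball. -/
theorem IsCompactOperator.tendsto_comp_left {S : X →L[𝕜] Y} (hS : IsCompactOperator S)
    {P : ℕ → Y →L[𝕜] Y} (hP : ∀ n, ‖P n‖ ≤ 1) (hlim : ∀ y, Tendsto (fun n => P n y) atTop (𝓝 y)) :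
    Tendsto (fun n => P n ∘L S) atTop (𝓝 S) := by
  rw [Metric.tendsto_nhds]
  intro ε hε
  have htb : TotallyBounded (S '' Metric.closedBall 0 1) :=
    (IsCompactOperator.isCompact_closure_image_closedBall (f := (S : X →ₗ[𝕜] Y)) hS
      1).totallyBounded.subset subset_closure
  obtain ⟨t, ht, hcov⟩ := Metric.totallyBounded_iff.1 htb (ε / 4) (by positivity)
  have hev : ∀ᶠ n in atTop, ∀ y ∈ t, dist (P n y) y < ε / 4 :=
    (ht.eventually_all).2 fun y _ => (Metric.tendsto_nhds.1 (hlim y)) _ (by positivity)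
  filter_upwards [hev] with n hn
  rw [dist_eq_norm]
  have hbound : ‖P n ∘L S - S‖ ≤ 3 * (ε / 4) := by
    refine ContinuousLinearMap.opNorm_le_of_unit_norm (by positivity) fun x hx => ?_
    obtain ⟨y, hy, hxy⟩ := Set.mem_iUnion₂.1 (hcov ⟨x, by simp [hx], rfl⟩)
    have h1 := hn y hy
    rw [Metric.mem_ball, dist_eq_norm] at hxy
    rw [dist_eq_norm] at h1
    have h2 : ‖P n (S x - y)‖ ≤ ‖S x - y‖ :=
      ((P n).le_opNorm _).trans (mul_le_of_le_one_left (norm_nonneg _) (hP n))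
    have h3 : (P n ∘L S - S) x = P n (S x - y) + (P n y - y) - (S x - y) := by
      simp only [sub_apply, ContinuousLinearMap.comp_apply, map_sub]
      abel
    rw [h3]
    refine (norm_sub_le _ _).trans ?_
    have h4 := norm_add_le (P n (S x - y)) (P n y - y)
    linarith
  linarith

variable (X) in
/-- Let `Pₙ` be compact contractions on `Y` tending strongly to the identity, with `Pₘ Pₙ = Pₙ` for
`n ≤ m`. If `Pₙ T₁` and `(Id - Pₘ) T₂ (Id - K)` are almost `ℓ_∞`-orthogonal for a suitable compact
operator `K`, then the compact operators from `X` to `Y` are an M-ideal. -/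
theorem isMIdeal_compactOperator_of_approx [CompleteSpace Y] {P : ℕ → Y →L[𝕜] Y}
    (hPc : ∀ n, IsCompactOperator (P n)) (hP : ∀ n, ‖P n‖ ≤ 1)
    (hlim : ∀ y, Tendsto (fun n => P n y) atTop (𝓝 y))
    (H : ∀ T₁ T₂ : X →L[𝕜] Y, ‖T₁‖ ≤ 1 → ‖T₂‖ ≤ 1 → ∀ n, ∀ ε > 0, ∃ K : X →L[𝕜] X,
      IsCompactOperator K ∧ ∀ m ≥ n,
        ‖P n ∘L T₁ + (T₂ ∘L (.id 𝕜 X - K) - P m ∘L (T₂ ∘L (.id 𝕜 X - K)))‖ ≤ 1 + ε) :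
    IsMIdeal (compactOperator (RingHom.id 𝕜) X Y) := by
  -- The sequence `f (P n ∘L T)` is bounded but need not visibly converge; an ultrafilter gives
  -- limits that are linear in both `f` and `T`.
  let U : Ultrafilter ℕ := hyperfilter ℕ
  have hU : (U : Filter ℕ) ≤ atTop := Nat.hyperfilter_le_atTop
  have hfP : ∀ (f : StrongDual 𝕜 (X →L[𝕜] Y)) (T : X →L[𝕜] Y) n, ‖f (P n ∘L T)‖ ≤ ‖f‖ * ‖T‖ :=
    fun f T n => (f.le_opNorm _).trans (mul_le_mul_of_nonneg_left
      (ContinuousLinearMap.norm_comp_le_of_norm_le_one (hP n) T) (norm_nonneg _))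
  have hex : ∀ (f : StrongDual 𝕜 (X →L[𝕜] Y)) (T : X →L[𝕜] Y),
      ∃ l, Tendsto (fun n => f (P n ∘L T)) U (𝓝 l) := fun f T => by
    obtain ⟨l, -, hl⟩ := (isCompact_closedBall (0 : 𝕜) (‖f‖ * ‖T‖)).ultrafilter_le_nhds
      (U.map fun n => f (P n ∘L T)) (by
        rw [Ultrafilter.coe_map, le_principal_iff]
        exact Filter.mem_map.2 (univ_mem' fun n => by simpa using hfP f T n))
    exact ⟨l, hl⟩
  choose l hl using hex
  have hbd : ∀ f T, ‖l f T‖ ≤ ‖f‖ * ‖T‖ := fun f T =>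
    le_of_tendsto (hl f T).norm (Eventually.of_forall fun n => hfP f T n)
  let π₀ : StrongDual 𝕜 (X →L[𝕜] Y) → StrongDual 𝕜 (X →L[𝕜] Y) := fun f =>
    LinearMap.mkContinuous
      { toFun := l f
        map_add' := fun S T => tendsto_nhds_unique (hl f (S + T)) (by
          simpa only [ContinuousLinearMap.comp_add, map_add] using (hl f S).add (hl f T))
        map_smul' := fun c T => tendsto_nhds_unique (hl f (c • T)) (by
          simpa only [ContinuousLinearMap.comp_smul, map_smul, RingHom.id_apply] using
            (hl f T).const_smul c) } ‖f‖ (hbd f)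
  let π : StrongDual 𝕜 (X →L[𝕜] Y) →L[𝕜] StrongDual 𝕜 (X →L[𝕜] Y) :=
    LinearMap.mkContinuous
      { toFun := π₀
        map_add' := fun f g => ContinuousLinearMap.ext fun T =>
          tendsto_nhds_unique (hl (f + g) T) ((hl f T).add (hl g T))
        map_smul' := fun c f => ContinuousLinearMap.ext fun T =>
          tendsto_nhds_unique (hl (c • f) T) ((hl f T).const_smul c) } 1 fun f => by
      have h : ‖π₀ f‖ ≤ ‖f‖ := ContinuousLinearMap.opNorm_le_bound (π₀ f) (norm_nonneg f) (hbd f)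
      rwa [one_mul]
  have hπ : ∀ f T, Tendsto (fun n => f (P n ∘L T)) U (𝓝 (π f T)) := hl
  have hπc : ∀ f (S : X →L[𝕜] Y), IsCompactOperator S → π f S = f S := fun f S hS =>
    tendsto_nhds_unique (hπ f S)
      (((f.continuous.tendsto S).comp (hS.tendsto_comp_left hP hlim)).mono_left hU)
  have hPT : ∀ n (T : X →L[𝕜] Y), IsCompactOperator (P n ∘L T) := fun n T => (hPc n).comp_clm T
  have hker : ∀ f, f ∈ annihilatorInDual (compactOperator (RingHom.id 𝕜) X Y) ↔ π f = 0 := by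
    refine fun f => ⟨fun hf => ContinuousLinearMap.ext fun T => ?_, fun hf S hS => ?_⟩
    · refine tendsto_nhds_unique (hπ f T) ?_
      have : (fun n => f (P n ∘L T)) = fun _ => 0 := funext fun n => hf _ (hPT n T)
      rw [this]
      exact tendsto_const_nhds
    · rw [← hπc f S hS, hf]; rfl
  have hidem : ∀ f, π (π f) = π f := fun f => by
    rw [← sub_eq_zero, ← map_sub, ← hker]
    intro S hS
    rw [sub_apply, hπc f S hS, sub_self]
  have hball : ∀ f (T₁ T₂ : X →L[𝕜] Y), ‖T₁‖ ≤ 1 → ‖T₂‖ ≤ 1 →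
      ‖π f T₁ + (f - π f) T₂‖ ≤ ‖f‖ := by
    intro f T₁ T₂ h₁ h₂
    refine le_of_tendsto ((hπ f T₁).add_const _).norm (Eventually.of_forall fun n => ?_)
    have hε : ∀ ε > 0, ‖f (P n ∘L T₁) + (f - π f) T₂‖ ≤ ‖f‖ * (1 + ε) := by
      intro ε hε
      obtain ⟨K, hK, hm⟩ := H T₁ T₂ h₁ h₂ n ε hε
      set R := T₂ ∘L (ContinuousLinearMap.id 𝕜 X - K) with hR
      -- `f - π f` vanishes on compact operators, so `T₂` may be replaced by `T₂ (Id - K)`. The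
      -- operator `K` depends on `n` but not on `m`, so the inner limit over `m` can be taken first.
      have h3 : (f - π f) T₂ = f R - π f R := by
        have h4 : R = T₂ - T₂ ∘L K := by
          rw [hR, ContinuousLinearMap.comp_sub, ContinuousLinearMap.comp_id]
        have h5 : IsCompactOperator (T₂ ∘L K) := hK.clm_comp T₂
        rw [h4, map_sub, map_sub, hπc f _ h5, sub_apply]
        ring
      rw [h3]
      refine le_of_tendsto ((((hπ f R).const_sub (f R))).const_add (f (P n ∘L T₁))).norm ?_
      filter_upwards [hU (eventually_ge_atTop n)] with m hmn
      rw [← map_sub, ← map_add]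
      exact (f.le_opNorm _).trans (mul_le_mul_of_nonneg_left (hm m hmn) (norm_nonneg _))
    have hlim' : Tendsto (fun ε : ℝ => ‖f‖ * (1 + ε)) (𝓝[>] 0) (𝓝 ‖f‖) := by
      have h0 : ContinuousAt (fun ε : ℝ => ‖f‖ * (1 + ε)) 0 := by fun_prop
      simpa using h0.tendsto.mono_left (nhdsWithin_le_nhds (s := Set.Ioi 0))
    exact ge_of_tendsto hlim' (eventually_nhdsWithin_of_forall fun ε h => hε ε h)
  have hsum : ∀ f, ‖f - π f‖ + ‖π f‖ ≤ ‖f‖ := by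
    intro f
    have h0 : ∀ T₁ T₂ : X →L[𝕜] Y, ‖T₁‖ ≤ 1 → ‖T₂‖ ≤ 1 → ‖π f T₁‖ + ‖(f - π f) T₂‖ ≤ ‖f‖ := by
      intro T₁ T₂ h₁ h₂
      obtain ⟨c, hc, hc'⟩ := RCLike.exists_norm_one_mul_eq (π f T₁)
      obtain ⟨d, hd, hd'⟩ := RCLike.exists_norm_one_mul_eq ((f - π f) T₂)
      have h3 := hball f (c • T₁) (d • T₂) (by rwa [norm_smul, hc, one_mul])
        (by rwa [norm_smul, hd, one_mul])
      rw [map_smul, map_smul, smul_eq_mul, smul_eq_mul, hc', hd', ← RCLike.ofReal_add,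
        RCLike.norm_ofReal] at h3
      exact (le_abs_self _).trans h3
    have h1 : ∀ T₁ : X →L[𝕜] Y, ‖T₁‖ ≤ 1 → ‖f - π f‖ ≤ ‖f‖ - ‖π f T₁‖ := fun T₁ h₁ =>
      ContinuousLinearMap.opNorm_le_of_unit_norm
        (sub_nonneg.2 (by simpa using h0 T₁ 0 h₁ (by simp)))
        fun T₂ h₂ => by linarith [h0 T₁ T₂ h₁ h₂.le]
    have h2 : ‖π f‖ ≤ ‖f‖ - ‖f - π f‖ :=
      ContinuousLinearMap.opNorm_le_of_unit_norm
        (sub_nonneg.2 (by simpa using h1 0 (by simp)))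
        fun T₁ h₁ => by linarith [h1 T₁ h₁.le]
    linarith
  have hproj : IsIdempotentElem (π : StrongDual 𝕜 (X →L[𝕜] Y) →ₗ[𝕜] StrongDual 𝕜 (X →L[𝕜] Y)) :=
    LinearMap.ext hidem
  have hann : annihilatorInDual (compactOperator (RingHom.id 𝕜) X Y) = LinearMap.ker
      (π : StrongDual 𝕜 (X →L[𝕜] Y) →ₗ[𝕜] StrongDual 𝕜 (X →L[𝕜] Y)) :=
    Submodule.ext fun f => hker f
  refine ⟨isClosed_setOfPred_isCompactOperator, LinearMap.range
    (π : StrongDual 𝕜 (X →L[𝕜] Y) →ₗ[𝕜] StrongDual 𝕜 (X →L[𝕜] Y)), ?_, ?_, ?_⟩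
  · convert isClosed_eq π.continuous continuous_id using 1
    ext f
    exact ⟨by rintro ⟨g, rfl⟩; exact hidem g, fun h => ⟨f, h⟩⟩
  · rw [hann]
    exact (LinearMap.IsIdempotentElem.isCompl hproj).symm
  · rintro f hf _ ⟨g, rfl⟩
    refine le_antisymm (norm_add_le _ _) ?_
    have h1 : π (f + π g) = π g := by rw [map_add, (hker f).1 hf, zero_add, hidem]
    have h2 := hsum (f + π g)
    rw [h1, add_sub_cancel_right] at h2
    exact h2

end

/-! ### Truncations of `ℓ_p` -/

section

variable {𝕜 : Type*} [RCLike 𝕜] {p : ℝ≥0∞}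

theorem lp.norm_add_rpow_of_disjoint (hp : 0 < p.toReal) {y z : lp (fun _ : ℕ => 𝕜) p}
    (h : ∀ i, y i = 0 ∨ z i = 0) :
    ‖y + z‖ ^ p.toReal = ‖y‖ ^ p.toReal + ‖z‖ ^ p.toReal := by
  refine (lp.hasSum_norm hp (y + z)).unique ?_
  convert (lp.hasSum_norm hp y).add (lp.hasSum_norm hp z) using 2 with i
  rcases h i with h | h <;> simp [h, Real.zero_rpow hp.ne']

variable [Fact (1 ≤ p)]

variable (𝕜 p) in
/-- The projection of `ℓ_p` onto the first `n` coordinates. -/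
noncomputable def lp.truncate (n : ℕ) :
    lp (fun _ : ℕ => 𝕜) p →L[𝕜] lp (fun _ : ℕ => 𝕜) p :=
  ∑ i ∈ Finset.range n,
    lp.singleContinuousLinearMap 𝕜 (fun _ : ℕ => 𝕜) p i ∘L lp.evalCLM 𝕜 (fun _ : ℕ => 𝕜) p i

theorem lp.truncate_eq_sum (n : ℕ) (y : lp (fun _ : ℕ => 𝕜) p) :
    lp.truncate 𝕜 p n y = ∑ i ∈ Finset.range n, lp.single p i (y i) := by
  simp only [lp.truncate, sum_apply]
  rfl

theorem lp.truncate_apply (n : ℕ) (y : lp (fun _ : ℕ => 𝕜) p) (i : ℕ) :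
    lp.truncate 𝕜 p n y i = if i < n then y i else 0 := by
  rw [lp.truncate_eq_sum]
  simp only [lp.coeFn_sum, lp.coeFn_single, Finset.sum_apply, Finset.sum_pi_single,
    Finset.mem_range]

theorem lp.norm_rpow_eq_truncate (hp : 0 < p.toReal) (n : ℕ) (y : lp (fun _ : ℕ => 𝕜) p) :
    ‖y‖ ^ p.toReal =
      ‖lp.truncate 𝕜 p n y‖ ^ p.toReal + ‖y - lp.truncate 𝕜 p n y‖ ^ p.toReal := by
  rw [← lp.norm_add_rpow_of_disjoint hp, add_sub_cancel]
  intro i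
  rw [lp.coeFn_sub, Pi.sub_apply, lp.truncate_apply]
  split_ifs <;> simp

theorem lp.norm_truncate_apply_le (hp : 0 < p.toReal) (n : ℕ) (y : lp (fun _ : ℕ => 𝕜) p) :
    ‖lp.truncate 𝕜 p n y‖ ≤ ‖y‖ := by
  rw [← Real.rpow_le_rpow_iff (norm_nonneg _) (norm_nonneg _) hp, lp.norm_rpow_eq_truncate hp n y]
  exact le_add_of_nonneg_right (by positivity)

theorem lp.norm_sub_truncate_apply_le (hp : 0 < p.toReal) (n : ℕ) (y : lp (fun _ : ℕ => 𝕜) p) :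
    ‖y - lp.truncate 𝕜 p n y‖ ≤ ‖y‖ := by
  rw [← Real.rpow_le_rpow_iff (norm_nonneg _) (norm_nonneg _) hp, lp.norm_rpow_eq_truncate hp n y]
  exact le_add_of_nonneg_left (by positivity)

theorem lp.isCompactOperator_truncate (n : ℕ) : IsCompactOperator (lp.truncate 𝕜 p n) :=
  (compactOperator (RingHom.id 𝕜) (lp (fun _ : ℕ => 𝕜) p) (lp (fun _ : ℕ => 𝕜) p)).sum_mem
    fun i _ => (isCompactOperator_of_locallyCompactSpace_rng
      (lp.singleContinuousLinearMap 𝕜 (fun _ : ℕ => 𝕜) p i)).comp_clm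
        (lp.evalCLM 𝕜 (fun _ : ℕ => 𝕜) p i)

theorem lp.tendsto_truncate (hp : p ≠ ⊤) (y : lp (fun _ : ℕ => 𝕜) p) :
    Tendsto (fun n => lp.truncate 𝕜 p n y) atTop (𝓝 y) := by
  simp only [lp.truncate_eq_sum]
  exact (lp.hasSum_single hp y).tendsto_sum_nat

end

/-! ### Verification of the criterion for `ℓ_p` -/

/-- The compact operators from `X` to `ℓ_p` form an M-ideal if `X` has an unconditional compact
approximating sequence, satisfies Clarkson's inequality for `p`, and is uniformly smooth. -/
theorem isMIdeal_compactOperator_lp {𝕜 : Type*} [RCLike 𝕜] {p : ℝ≥0∞} [Fact (1 ≤ p)] (hp : p ≠ ⊤)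
    {X : Type*} [NormedAddCommGroup X] [NormedSpace 𝕜 X]
    (hclark : TwoPointBound 𝕜 X p.toReal 1 (2 ^ (p.toReal - 1)) (2 ^ (p.toReal - 1)))
    {C : ℝ} (hC : 0 ≤ C) (hsm : ∀ t : ℝ, 0 ≤ t → t ≤ 1 →
      TwoPointBound 𝕜 X p.toReal t (2 + C * t ^ 2) (C * t ^ 2))
    {K : ℕ → X →L[𝕜] X} (hKc : ∀ n, IsCompactOperator (K n))
    (hK : ∀ x, Tendsto (fun n => K n x) atTop (𝓝 x))
    (hK1 : ∀ ε > 0, ∀ᶠ n in atTop, ‖ContinuousLinearMap.id 𝕜 X - (2 : 𝕜) • K n‖ ≤ 1 + ε) :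
    IsMIdeal (compactOperator (RingHom.id 𝕜) X (lp (fun _ : ℕ => 𝕜) p)) := by
  have hr1 : 1 ≤ p.toReal := by simpa using ENNReal.toReal_mono hp (Fact.out : 1 ≤ p)
  have hr : 0 < p.toReal := by linarith
  refine isMIdeal_compactOperator_of_approx X (P := lp.truncate 𝕜 p)
    lp.isCompactOperator_truncate
    (fun n => ContinuousLinearMap.opNorm_le_bound _ zero_le_one fun y => by
      rw [one_mul]; exact lp.norm_truncate_apply_le hr n y) (lp.tendsto_truncate hp) ?_
  intro T₁ T₂ h₁ h₂ n ε hε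
  have hST : Tendsto (fun k => (lp.truncate 𝕜 p n ∘L T₁) ∘L K k) atTop
      (𝓝 (lp.truncate 𝕜 p n ∘L T₁)) := by
    -- Only `n` coordinate functionals of `T₁` are involved, so norm convergence of functionals
    -- suffices.
    have hsum : ∀ T : X →L[𝕜] lp (fun _ : ℕ => 𝕜) p, lp.truncate 𝕜 p n ∘L T =
        ∑ i ∈ Finset.range n, lp.singleContinuousLinearMap 𝕜 (fun _ : ℕ => 𝕜) p i ∘L
          (lp.evalCLM 𝕜 (fun _ : ℕ => 𝕜) p i ∘L T) := fun T => by
      ext1 x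
      simp [lp.truncate]
    refine Tendsto.congr (fun k => (hsum (T₁ ∘L K k)).symm) ?_
    rw [hsum T₁]
    refine tendsto_finsetSum _ fun i _ => ?_
    have h3 := tendsto_comp_of_smooth hr1 hC hsm hK hK1
      (lp.evalCLM 𝕜 (fun _ : ℕ => 𝕜) p i ∘L T₁)
    exact ((ContinuousLinearMap.compL 𝕜 X 𝕜 (lp (fun _ : ℕ => 𝕜) p)
      (lp.singleContinuousLinearMap 𝕜 (fun _ : ℕ => 𝕜) p i)).continuous.tendsto _).comp h3
  have hε2 : 0 < ε / 2 := by positivity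
  obtain ⟨k, hk1, hk2⟩ := ((hK1 _ hε2).and (Metric.tendsto_nhds.1 hST _ hε2)).exists
  refine ⟨K k, hKc k, fun m hm => ?_⟩
  set R := T₂ ∘L (ContinuousLinearMap.id 𝕜 X - K k)
  have hmain : ‖(lp.truncate 𝕜 p n ∘L T₁) ∘L K k + (R - lp.truncate 𝕜 p m ∘L R)‖ ≤ 1 + ε / 2 := by
    refine ContinuousLinearMap.opNorm_le_bound _ (by positivity) fun x => ?_
    rw [← Real.rpow_le_rpow_iff (norm_nonneg _) (by positivity) hr]
    refine le_trans ?_ (hclark.norm_rpow_add_norm_rpow_le hr.le hε2.le hk1 x)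
    have h3 : ((lp.truncate 𝕜 p n ∘L T₁) ∘L K k + (R - lp.truncate 𝕜 p m ∘L R)) x =
      lp.truncate 𝕜 p n (T₁ (K k x)) + (T₂ (x - K k x) - lp.truncate 𝕜 p m (T₂ (x - K k x))) := rfl
    rw [h3, lp.norm_add_rpow_of_disjoint hr]
    · have h4 : ‖T₁ (K k x)‖ ≤ ‖K k x‖ := by simpa using T₁.le_of_opNorm_le h₁ (K k x)
      have h5 : ‖T₂ (x - K k x)‖ ≤ ‖x - K k x‖ := by
        simpa using T₂.le_of_opNorm_le h₂ (x - K k x)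
      have h6 := (lp.norm_truncate_apply_le hr n (T₁ (K k x))).trans h4
      have h7 := (lp.norm_sub_truncate_apply_le hr m (T₂ (x - K k x))).trans h5
      gcongr
    -- This is where `m ≥ n` enters: coordinates below `n` are killed by `Id - P m`, the others by
    -- `P n`.
    · intro i
      rw [lp.coeFn_sub, Pi.sub_apply, lp.truncate_apply, lp.truncate_apply]
      by_cases hi : i < n
      · right; rw [if_pos (hi.trans_le hm), sub_self]
      · left; rw [if_neg hi]
  rw [dist_comm, dist_eq_norm] at hk2
  have h8 : lp.truncate 𝕜 p n ∘L T₁ + (R - lp.truncate 𝕜 p m ∘L R) =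
      (lp.truncate 𝕜 p n ∘L T₁ - (lp.truncate 𝕜 p n ∘L T₁) ∘L K k) +
        ((lp.truncate 𝕜 p n ∘L T₁) ∘L K k + (R - lp.truncate 𝕜 p m ∘L R)) := by abel
  rw [h8]
  refine (norm_add_le _ _).trans ?_
  linarith

theorem corollary3p9 {𝕜 : Type*} [RCLike 𝕜] (p : ℝ≥0∞) [Fact (1 ≤ p)] (hp2 : 2 ≤ p) (hp : p ≠ ⊤)
    (X : Type*) [NormedAddCommGroup X] [NormedSpace 𝕜 X] [CompleteSpace X]
    (hX : IsSubspaceOfQuotient 𝕜 X (Lp 𝕜 p (volume.restrict (Set.Icc (0 : ℝ) 1))))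
    (h : HasOneUnconditionalFDD 𝕜 X ∨ HasUMCAP 𝕜 X) :
    IsMIdeal (compactOperator (RingHom.id 𝕜) X (lp (fun _ : ℕ => 𝕜) p)) := by
  have hclark := hX.clarkson hp2 hp
  obtain ⟨C, hC, hsm⟩ := hX.exists_smooth hp2 hp
  rcases h with h | ⟨K, hKc, hK, hK1⟩
  · obtain ⟨K, hKc, hK, hK1⟩ := h.exists_compact_approx
    exact isMIdeal_compactOperator_lp hp hclark hC hsm hKc hK fun ε hε =>
      Eventually.of_forall fun n => (hK1 n).trans (by linarith)
  · exact isMIdeal_compactOperator_lp hp hclark hC hsm hKc hK fun ε hε =>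
      (hK1.eventually (gt_mem_nhds (by linarith : (1 : ℝ) < 1 + ε))).mono fun n hn => hn.le
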